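/- All graphs are finite, without loops and multiple edges. For a graph $X$, let $L(X)$ be its line graph, and let $X''=X\times K_2$ be its Kronecker double cover: the vertex set is $V(X)\times V(K_2)$, and $(u,i)$, $(v,j)$ are adjacent if and only if $u,v$ are adjacent in $X$ and $i\neq j$. Let each edge of $X$ be taken with both of its orientations, and for an oriented edge $e$ let $s(e)$ and $t(e)$ be its starting and terminal vertex. The edge adjacency matrix $M$ of $X$ is indexed by the oriented edges of $X$, with $M_{ef}=1$ if $t(e)=s(f)$ and $s(e)\neq t(f)$, and $M_{ef}=0$ otherwise. The symmetric edge graph $\gamma(X)$ is the graph on the oriented edges of $X$ whose adjacency matrix is $M+M^T$. Theorem. Let $X$ be a connected graph. Then: 1. $\gamma(X)$ is isomorphic to $L(X)''$ if and only if $X$ is bipartite. 2. $\gamma(X)$ is isomorphic to $L(X'')$ if and only if one of the following holds: $X$ is a path graph $P_n$ on $n\geq 1$ vertices; $X$ is a cycle graph $C_n$ with $n\ge 3$ even; $X$ is isomorphic to $K_4$, to $K_4-e$ (the graph $K_4$ with one edge removed), or to a triangle with a pendant vertex (a triangle together with one further vertex that is adjacent to exactly one vertex of the triangle). 3. $L(X'')$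 is isomorphic to $L(X)''$ if and only if $X$ is a cycle graph $C_n$ with $n\ge 3$ or a path graph $P_n$ with $n\geq 1$. -/

import Mathlib

namespace SimpleGraph

/-- The Kronecker product of two graphs: `(u, u')` and `(v, v')` are adjacent iff
`u` is adjacent to `v` and `u'` is adjacent to `v'`. -/
def kroneckerProd {V W : Type*} (X : SimpleGraph V) (Y : SimpleGraph W) :
    SimpleGraph (V × W) where
  Adj p q := X.Adj p.1 q.1 ∧ Y.Adj p.2 q.2
  symm := ⟨fun _ _ h => ⟨h.1.symm, h.2.symm⟩⟩
  loopless := ⟨fun _ h => h.1.ne rfl⟩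

/-- The Kronecker double cover of `X`: its Kronecker product with `K₂`. -/
def kroneckerDouble {V : Type*} (X : SimpleGraph V) : SimpleGraph (V × Fin 2) :=
  X.kroneckerProd (completeGraph (Fin 2))

open Classical in
/-- The edge adjacency matrix of `X`, indexed by the oriented edges of `X` (every edge occurs with
both orientations): the entry at `(e, f)` is `1` if `f` starts where `e` ends and `f` does not
end where `e` starts, and `0` otherwise. -/
noncomputable def edgeAdjMatrix {V : Type*} (X : SimpleGraph V) : Matrix X.Dart X.Dart ℕ :=
  Matrix.of fun e f => if e.snd = f.fst ∧ e.fst ≠ f.snd then 1 else 0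

/-- The symmetric edge graph of `X`, on the oriented edges of `X`. -/
def symmEdgeGraph {V : Type*} (X : SimpleGraph V) : SimpleGraph X.Dart where
  Adj e f := (e.snd = f.fst ∧ e.fst ≠ f.snd) ∨ (f.snd = e.fst ∧ f.fst ≠ e.snd)
  symm := ⟨fun _ _ h => h.symm⟩
  loopless := ⟨fun e h => h.elim (fun h => e.snd_ne_fst h.1) (fun h => e.snd_ne_fst h.1)⟩

open Classical in
/-- The symmetric edge graph of `X` is the graph with adjacency matrix `M + Mᵀ`, where `M` is
the edge adjacency matrix of `X`. -/
theorem adjMatrix_symmEdgeGraph {V : Type*} (X : SimpleGraph V) :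
    X.symmEdgeGraph.adjMatrix ℕ = X.edgeAdjMatrix + X.edgeAdjMatrix.transpose := by
  ext e f
  have h : X.symmEdgeGraph.Adj e f ↔
      (e.snd = f.fst ∧ e.fst ≠ f.snd) ∨ (f.snd = e.fst ∧ f.fst ≠ e.snd) := Iff.rfl
  simp only [adjMatrix_apply, h, edgeAdjMatrix, Matrix.add_apply, Matrix.of_apply,
    Matrix.transpose_apply]
  grind

/-- `X` is a path graph `Pₙ` (on `n` vertices). -/
def IsPathGraph {V : Type*} (X : SimpleGraph V) : Prop :=
  ∃ n : ℕ, 1 ≤ n ∧ Nonempty (X ≃g pathGraph n)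

/-- `X` is a cycle graph `Cₙ` (on `n ≥ 3` vertices). -/
def IsCycleGraph {V : Type*} (X : SimpleGraph V) : Prop :=
  ∃ n : ℕ, 3 ≤ n ∧ Nonempty (X ≃g cycleGraph n)

/-- `X` is a cycle graph on an even number of vertices. -/
def IsEvenCycleGraph {V : Type*} (X : SimpleGraph V) : Prop :=
  ∃ n : ℕ, 3 ≤ n ∧ Even n ∧ Nonempty (X ≃g cycleGraph n)

/-- `K₄ - e`: the complete graph on four vertices with one edge removed. -/
def completeFourMinusEdge : SimpleGraph (Fin 4) :=
  (completeGraph (Fin 4)).deleteEdges {s(0, 1)}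

/-- The triangle on `0, 1, 2` with a pendant vertex `3` attached at `2`. -/
def triangleWithPendant : SimpleGraph (Fin 4) :=
  fromEdgeSet {s(0, 1), s(1, 2), s(0, 2), s(2, 3)}

end SimpleGraph

namespace SimpleGraph

variable {V W : Type*} {X : SimpleGraph V} {Y : SimpleGraph W}

/-! All three graphs live on the darts of `X`. Orienting each edge of `X''` from layer 0 to layer 1
turns it into a dart, so `L(X'')` joins darts that share a start or an end (`coincidenceGraphIso`),
while `γ(X)` joins darts that meet head to tail. A vertex of `L(X)''` is an edge with one of two
colors, that is, a dart once each dart and its reverse are colored differently.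

An isomorphism `γ(X) ≅ L(X)''` colors the darts so that non-backtracking steps change color, which
forces closed walks to be even; a bipartition gives such a coloring. For `L(X'') ≅ L(X)''` darts
with a common start must differ in color, so degrees are at most two and `X` is a path or a cycle;
both can be oriented suitably.

For `γ(X) ≅ L(X'')` with degrees at most two, `L(X'') ≅ L(X)''` reduces the question to
bipartiteness. If some vertex has three neighbors, compare local structure: `γ(X)` has no 4-clique
and its triangles come from triangles of `X`, while `L(X'')` has no claw. This confines `X` to four
vertices and leaves three graphs, settled by explicit bijections. -/

theorem symmEdgeGraph_adj {e f : X.Dart} : X.symmEdgeGraph.Adj e f ↔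
    (e.snd = f.fst ∧ e.fst ≠ f.snd) ∨ (f.snd = e.fst ∧ f.fst ≠ e.snd) :=
  Iff.rfl

/-- The graph on the oriented edges of `X` in which two distinct oriented edges are adjacent iff
they have the same start or the same end. -/
def coincidenceGraph (X : SimpleGraph V) : SimpleGraph X.Dart where
  Adj e f := e ≠ f ∧ (e.fst = f.fst ∨ e.snd = f.snd)
  symm := ⟨fun _ _ h => ⟨h.1.symm, h.2.imp Eq.symm Eq.symm⟩⟩
  loopless := ⟨fun _ h => h.1 rfl⟩

theorem coincidenceGraph_adj {e f : X.Dart} :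
    X.coincidenceGraph.Adj e f ↔ e ≠ f ∧ (e.fst = f.fst ∨ e.snd = f.snd) :=
  Iff.rfl

theorem kroneckerDouble_adj {p q : V × Fin 2} :
    X.kroneckerDouble.Adj p q ↔ X.Adj p.1 q.1 ∧ p.2 ≠ q.2 :=
  Iff.rfl

theorem dart_eq_iff {e f : X.Dart} : e = f ↔ e.fst = f.fst ∧ e.snd = f.snd := by
  rw [Dart.ext_iff, Prod.ext_iff]

theorem coincidenceGraph_adj_of_ne {v x y : V} (hx : X.Adj v x) (hy : X.Adj v y) (h : x ≠ y) :
    X.coincidenceGraph.Adj ⟨(v, x), hx⟩ ⟨(v, y), hy⟩ :=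
  ⟨fun h' => h (dart_eq_iff.1 h').2, Or.inl rfl⟩

/-- The edge of the Kronecker double cover that runs from the start of a dart in the first layer to
its end in the second layer. -/
def Dart.liftEdge (e : X.Dart) : X.kroneckerDouble.edgeSet :=
  ⟨s((e.fst, 0), (e.snd, 1)), ⟨e.adj, Fin.zero_ne_one⟩⟩

theorem Dart.liftEdge_bijective : Function.Bijective (Dart.liftEdge (X := X)) := by
  constructor
  · intro e f h
    have h' := congrArg Subtype.val h
    simp only [liftEdge, Sym2.eq_iff, Prod.mk.injEq] at h'
    rw [dart_eq_iff]
    simpa using h'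
  · rintro ⟨z, hz⟩
    induction z with | _ p q
    obtain ⟨u, i⟩ := p
    obtain ⟨v, j⟩ := q
    obtain ⟨h, hij⟩ : X.Adj u v ∧ i ≠ j := hz
    by_cases hi : i = 0
    · have hj : j = 1 := by omega
      subst hi hj
      exact ⟨⟨(u, v), h⟩, rfl⟩
    · have hi : i = 1 := by omega
      have hj : j = 0 := by omega
      subst hi hj
      exact ⟨⟨(v, u), h.symm⟩, Subtype.ext Sym2.eq_swap⟩

/-- The line graph of the Kronecker double cover is the coincidence graph. -/
noncomputable def coincidenceGraphIso (X : SimpleGraph V) :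
    X.coincidenceGraph ≃g X.kroneckerDouble.lineGraph where
  toEquiv := Equiv.ofBijective _ Dart.liftEdge_bijective
  map_rel_iff' {e f} := by
    simp only [Equiv.ofBijective_apply, lineGraph_adj_iff_exists, coincidenceGraph_adj,
      Dart.liftEdge_bijective.1.ne_iff]
    simp [Dart.liftEdge]

/-! ### Dart colorings and the double cover of the line graph -/

theorem Dart.exists_mem_edge_iff {e f : X.Dart} : (∃ v, v ∈ e.edge ∧ v ∈ f.edge) ↔
    e.fst = f.fst ∨ e.fst = f.snd ∨ e.snd = f.fst ∨ e.snd = f.snd := by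
  simp [Dart.edge, or_assoc]

/-- If a coloring of the darts separates each dart from its reverse, then darts correspond to
edges with a color. -/
theorem edge_color_bijective (s : X.Dart → Fin 2) (hs : ∀ e, s e.symm ≠ s e) :
    Function.Bijective fun e : X.Dart => ((⟨e.edge, e.edge_mem⟩, s e) : X.edgeSet × Fin 2) := by
  constructor
  · intro e f h
    simp only [Prod.mk.injEq, Subtype.mk.injEq, dart_edge_eq_iff] at h
    obtain ⟨rfl | rfl, h⟩ := h
    · rfl
    · exact absurd h (hs f)
  · rintro ⟨⟨z, hz⟩, i⟩
    induction z with | _ u v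
    let e : X.Dart := ⟨(u, v), hz⟩
    by_cases hi : s e = i
    · exact ⟨e, Prod.ext rfl hi⟩
    · refine ⟨e.symm, Prod.ext (Subtype.ext e.edge_symm) ?_⟩
      have := hs e
      change s e.symm = i
      omega

/-- If consecutive darts have different colors then the symmetric edge graph is the Kronecker
double cover of the line graph. -/
noncomputable def symmEdgeGraphIsoOfColor (s : X.Dart → Fin 2)
    (hs : ∀ e f : X.Dart, e.snd = f.fst → s e ≠ s f) :
    X.symmEdgeGraph ≃g X.lineGraph.kroneckerDouble where
  toEquiv := Equiv.ofBijective _ (edge_color_bijective s fun e => hs _ _ rfl)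
  map_rel_iff' {e f} := by
    simp only [Equiv.ofBijective_apply, kroneckerDouble_adj, lineGraph_adj_iff_exists,
      Dart.exists_mem_edge_iff, ne_eq, Subtype.mk.injEq, dart_edge_eq_iff, symmEdgeGraph_adj]
    -- Darts with a common start or end both differ in color from one reversed dart, so they agree
    -- in color and are not adjacent in the double cover.
    have h1 := hs e f
    have h2 := hs f e
    have h3 := hs e f.symm
    have h4 := hs e.symm f
    have h5 := hs f.symm f rfl
    have h6 := hs e.symm e rfl
    simp only [dart_eq_iff, Dart.symm, Prod.fst_swap, Prod.snd_swap] at *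
    grind

/-- If distinct darts with the same start, and each dart and its reverse, have different colors
then the coincidence graph is the Kronecker double cover of the line graph. -/
noncomputable def coincidenceGraphIsoOfColor (s : X.Dart → Fin 2)
    (hs : ∀ e : X.Dart, s e.symm ≠ s e) (hs' : ∀ e f : X.Dart, e ≠ f → e.fst = f.fst → s e ≠ s f) :
    X.coincidenceGraph ≃g X.lineGraph.kroneckerDouble where
  toEquiv := Equiv.ofBijective _ (edge_color_bijective s hs)
  map_rel_iff' {e f} := by
    simp only [Equiv.ofBijective_apply, kroneckerDouble_adj, lineGraph_adj_iff_exists,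
      Dart.exists_mem_edge_iff, ne_eq, Subtype.mk.injEq, dart_edge_eq_iff, coincidenceGraph_adj]
    -- If `e` ends where `f` starts, then `e.symm` differs in color from both `e` and `f`; with two
    -- colors `e` and `f` agree, so consecutive darts are not adjacent.
    have h1 := hs' e f
    have h2 := hs' e f.symm
    have h3 := hs' e.symm f
    have h4 := hs' e.symm f.symm
    have h5 := hs f
    have h6 := hs e
    clear * - h1 h2 h3 h4 h5 h6
    simp only [ne_eq, dart_eq_iff, Dart.symm_toProd, Prod.fst_swap, Prod.snd_swap] at *
    generalize s e = a, s f = b, s e.symm = a', s f.symm = b' at *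
    have key : ∀ x y z : Fin 2, x = y ∨ y = z ∨ x = z := by decide
    have h7 := key a b a'
    have h8 := key a b b'
    grind

theorem IsBipartite.nonempty_symmEdgeGraph_iso (h : X.IsBipartite) :
    Nonempty (X.symmEdgeGraph ≃g X.lineGraph.kroneckerDouble) := by
  obtain ⟨c⟩ := h
  exact ⟨symmEdgeGraphIsoOfColor (fun e => c e.fst) fun e f h => h ▸ c.valid e.adj⟩

open Classical in
/-- An orientation in which every vertex has at most one outgoing and at most one ingoing edge
identifies the coincidence graph with the Kronecker double cover of the line graph. -/
theorem nonempty_coincidenceGraph_iso_of_orientation (R : V → V → Prop)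
    (h : ∀ u v, X.Adj u v → (R u v ↔ ¬ R v u))
    (h' : ∀ u v w, X.Adj u v → X.Adj u w → v ≠ w → (R u v ↔ ¬ R u w)) :
    Nonempty (X.coincidenceGraph ≃g X.lineGraph.kroneckerDouble) := by
  refine ⟨coincidenceGraphIsoOfColor (fun e => if R e.fst e.snd then 0 else 1) ?_ ?_⟩
  · intro e
    have := h _ _ e.adj
    by_cases h1 : R e.fst e.snd <;> simp_all [Dart.symm]
  · rintro ⟨⟨u, v⟩, he⟩ ⟨⟨w, x⟩, hf⟩ hne (rfl : u = w)
    have := h' _ _ _ he hf (by rintro rfl; exact hne rfl)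
    by_cases h1 : R u v <;> simp_all

theorem IsPathGraph.nonempty_coincidenceGraph_iso (h : X.IsPathGraph) :
    Nonempty (X.coincidenceGraph ≃g X.lineGraph.kroneckerDouble) := by
  obtain ⟨n, -, ⟨φ⟩⟩ := h
  have hφ : ∀ u v, X.Adj u v ↔ (φ u).val + 1 = (φ v).val ∨ (φ v).val + 1 = (φ u).val := fun u v => by
    rw [← φ.map_adj_iff, pathGraph_adj]
  refine nonempty_coincidenceGraph_iso_of_orientation (fun u v => (φ u).val < (φ v).val) ?_ ?_
  · intro u v h
    rw [hφ] at h
    omega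
  · intro u v w h h' hne
    rw [hφ] at h h'
    have : (φ v).val ≠ (φ w).val := fun h => hne (φ.injective (Fin.ext h))
    omega

theorem IsCycleGraph.nonempty_coincidenceGraph_iso (h : X.IsCycleGraph) :
    Nonempty (X.coincidenceGraph ≃g X.lineGraph.kroneckerDouble) := by
  obtain ⟨n, hn, ⟨φ⟩⟩ := h
  obtain ⟨n, rfl⟩ : ∃ m, n = m + 3 := ⟨n - 3, by omega⟩
  have hφ : ∀ u v, X.Adj u v ↔ φ u - φ v = 1 ∨ φ v - φ u = 1 := fun u v => by
    rw [← φ.map_adj_iff, cycleGraph_adj]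
  -- A step forward is not also a step backward; this is where length at least 3 enters.
  have h2 : (1 : Fin (n + 3)) ≠ -1 := by
    intro h
    have : (1 : Fin (n + 3)) + 1 = 0 := by nth_rewrite 1 [h]; simp
    simp [Fin.ext_iff, Fin.val_add, Nat.mod_eq_of_lt] at this
  refine nonempty_coincidenceGraph_iso_of_orientation (fun u v => φ v - φ u = 1) ?_ ?_
  · intro u v h
    rw [hφ] at h
    refine ⟨fun h1 h3 => h2 ?_, fun h1 => h.resolve_left h1⟩
    nth_rewrite 1 [← h1]
    rw [← neg_sub, h3]
  · intro u v w h h' hne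
    rw [hφ] at h h'
    refine ⟨fun h1 h3 => hne (φ.injective (sub_left_injective (h1.trans h3.symm))), fun h3 => ?_⟩
    refine h.resolve_left fun h1 => hne (φ.injective (sub_right_injective
      (h1.trans (h'.resolve_right h3).symm)))

/-! ### Transport along isomorphisms and the three exceptional graphs -/

/-- An isomorphism of graphs acts on the darts. -/
def Iso.dartEquiv (φ : X ≃g Y) : X.Dart ≃ Y.Dart where
  toFun := φ.toHom.mapDart
  invFun := φ.symm.toHom.mapDart
  left_inv _ := Dart.ext _ _ (Prod.ext (φ.symm_apply_apply _) (φ.symm_apply_apply _))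
  right_inv _ := Dart.ext _ _ (Prod.ext (φ.apply_symm_apply _) (φ.apply_symm_apply _))

theorem Iso.dartEquiv_fst (φ : X ≃g Y) (e : X.Dart) : (φ.dartEquiv e).fst = φ e.fst := rfl

theorem Iso.dartEquiv_snd (φ : X ≃g Y) (e : X.Dart) : (φ.dartEquiv e).snd = φ e.snd := rfl

/-- An isomorphism of graphs induces one of the symmetric edge graphs. -/
def Iso.symmEdgeGraph (φ : X ≃g Y) : X.symmEdgeGraph ≃g Y.symmEdgeGraph where
  toEquiv := φ.dartEquiv
  map_rel_iff' {e f} := by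
    simp [symmEdgeGraph_adj, dartEquiv_fst, dartEquiv_snd]

/-- An isomorphism of graphs induces one of the coincidence graphs. -/
def Iso.coincidenceGraph (φ : X ≃g Y) : X.coincidenceGraph ≃g Y.coincidenceGraph where
  toEquiv := φ.dartEquiv
  map_rel_iff' {e f} := by
    simp [coincidenceGraph_adj, dartEquiv_fst, dartEquiv_snd]

theorem nonempty_symmEdgeGraph_iso_coincidenceGraph_congr (φ : X ≃g Y)
    (h : Nonempty (Y.symmEdgeGraph ≃g Y.coincidenceGraph)) :
    Nonempty (X.symmEdgeGraph ≃g X.coincidenceGraph) :=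
  h.map fun ψ => φ.symmEdgeGraph.trans (ψ.trans φ.coincidenceGraph.symm)

/-- Phrased with vertices instead of darts so that `decide` can check a concrete table; finiteness
gives surjectivity. -/
theorem nonempty_symmEdgeGraph_iso_coincidenceGraph_of_map [Finite V] (F : V → V → V × V)
    (hF : ∀ u v, X.Adj u v → X.Adj (F u v).1 (F u v).2)
    (hinj : ∀ u v, X.Adj u v → ∀ w x, X.Adj w x → F u v = F w x → u = w ∧ v = x)
    (hadj : ∀ u v, X.Adj u v → ∀ w x, X.Adj w x →
      (((F u v).1 = (F w x).1 ∨ (F u v).2 = (F w x).2) ∧ ¬ (u = w ∧ v = x) ↔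
        (v = w ∧ u ≠ x) ∨ (x = u ∧ w ≠ v))) :
    Nonempty (X.symmEdgeGraph ≃g X.coincidenceGraph) := by
  have : Finite X.Dart := Finite.of_injective _ Dart.toProd_injective
  let G : X.Dart → X.Dart := fun e => ⟨F e.fst e.snd, hF _ _ e.adj⟩
  have hG : Function.Injective G := fun e f h =>
    dart_eq_iff.2 (hinj _ _ e.adj _ _ f.adj (congrArg Dart.toProd h))
  refine ⟨⟨Equiv.ofBijective G (Finite.injective_iff_bijective.1 hG), ?_⟩⟩
  intro e f
  rw [symmEdgeGraph_adj, ← hadj _ _ e.adj _ _ f.adj]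
  simp only [Equiv.ofBijective_apply, coincidenceGraph_adj, hG.ne_iff, ne_eq, dart_eq_iff]
  exact and_comm

theorem nonempty_symmEdgeGraph_iso_completeGraph_four :
    Nonempty ((completeGraph (Fin 4)).symmEdgeGraph ≃g
      (completeGraph (Fin 4)).coincidenceGraph) := by
  refine nonempty_symmEdgeGraph_iso_coincidenceGraph_of_map
    -- Row `u`, column `v` holds the image of the dart `(u, v)`; `(0, 0)` is filler where there is
    -- no dart.
    ![![(0, 0), (0, 1), (1, 2), (2, 0)],
      ![(1, 0), (0, 0), (3, 1), (0, 3)],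
      ![(2, 1), (1, 3), (0, 0), (3, 2)],
      ![(0, 2), (3, 0), (2, 3), (0, 0)]] ?_ ?_ ?_ <;>
  simp only [completeGraph, top_adj] <;> decide

theorem completeFourMinusEdge_adj {u v : Fin 4} :
    completeFourMinusEdge.Adj u v ↔ u ≠ v ∧ ¬ (u = 0 ∧ v = 1) ∧ ¬ (u = 1 ∧ v = 0) := by
  simp [completeFourMinusEdge, completeGraph]

theorem triangleWithPendant_adj {u v : Fin 4} : triangleWithPendant.Adj u v ↔
    u ≠ v ∧ (u ≠ 3 ∨ v = 2) ∧ (v ≠ 3 ∨ u = 2) := by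
  simp only [triangleWithPendant, fromEdgeSet_adj, Set.mem_insert_iff, Set.mem_singleton_iff,
    Sym2.eq_iff]
  revert u v
  decide

theorem nonempty_symmEdgeGraph_iso_completeFourMinusEdge :
    Nonempty (completeFourMinusEdge.symmEdgeGraph ≃g completeFourMinusEdge.coincidenceGraph) := by
  refine nonempty_symmEdgeGraph_iso_coincidenceGraph_of_map
    ![![(0, 0), (0, 0), (0, 2), (2, 0)],
      ![(0, 0), (0, 0), (3, 1), (1, 3)],
      ![(2, 1), (0, 3), (0, 0), (3, 2)],
      ![(1, 2), (3, 0), (2, 3), (0, 0)]] ?_ ?_ ?_ <;>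
  simp only [completeFourMinusEdge_adj] <;> decide

theorem nonempty_symmEdgeGraph_iso_triangleWithPendant :
    Nonempty (triangleWithPendant.symmEdgeGraph ≃g triangleWithPendant.coincidenceGraph) := by
  refine nonempty_symmEdgeGraph_iso_coincidenceGraph_of_map
    ![![(0, 0), (2, 3), (0, 2), (0, 0)],
      ![(3, 2), (0, 0), (2, 1), (0, 0)],
      ![(2, 0), (1, 2), (0, 0), (0, 1)],
      ![(0, 0), (0, 0), (1, 0), (0, 0)]] ?_ ?_ ?_ <;>
  simp only [triangleWithPendant_adj] <;> decide

/-! ### Necessity of bipartiteness -/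

/-- If the darts are two-colored so that the two darts of a path of length two have different
colors, then every closed walk, given as a sequence of vertices, has even length. -/
theorem even_of_closed_sequence (c : V → V → Bool)
    (hc : ∀ u v w, X.Adj u v → X.Adj v w → u ≠ w → c u v ≠ c v w) (n : ℕ) (f : ℕ → V)
    (hf : ∀ i < n, X.Adj (f i) (f (i + 1))) (hn : f n = f 0) : Even n := by
  induction n using Nat.strong_induction_on generalizing f with | _ n ih
  have even_of_sub : 2 ≤ n → Even (n - 2) → Even n := by
    intro h1 h2
    rw [Nat.even_sub h1] at h2
    exact h2.2 even_two
  by_cases hb : ∃ i, i + 2 ≤ n ∧ f i = f (i + 2)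
  -- Cutting out a backtrack shortens the closed walk by two.
  · obtain ⟨i, hi, hfi⟩ := hb
    refine even_of_sub (by omega) (ih (n - 2) (by omega)
      (fun j => if j ≤ i then f j else f (j + 2)) ?_ ?_)
    · intro j hj
      rcases lt_trichotomy j i with h | rfl | h
      · simpa [h.le, Nat.succ_le_of_lt h] using hf j (by omega)
      · simpa [hfi] using hf (j + 2) (by omega)
      · simpa [not_le.2 h, not_le.2 (h.trans (Nat.lt_succ_self j))] using hf (j + 2) (by omega)
    · by_cases h : n - 2 ≤ i
      · obtain rfl : n = i + 2 := by omega
        simp [hfi, hn]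
      · simp [h, Nat.sub_add_cancel (show 2 ≤ n by omega), hn]
  · push Not at hb
    rcases n with _ | _ | n
    · exact Even.zero
    · exact absurd hn.symm (hf 0 (by omega)).ne
    -- A backtrack may also sit at the base point; then the first and last steps are dropped.
    · by_cases h1 : f 1 = f (n + 1)
      · exact even_of_sub (by omega) (ih n (by omega) (fun j => f (j + 1))
          (fun j hj => hf _ (by omega)) h1.symm)
      -- Without backtracks the colors alternate all the way around, including from the last dart to
      -- the first.
      · have key : ∀ i < n + 2, (c (f i) (f (i + 1)) = c (f 0) (f 1) ↔ Even i) := by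
          intro i
          induction i with
          | zero => simp
          | succ i ihi =>
            intro hi
            have h2 := hc _ _ _ (hf i (by omega)) (hf (i + 1) hi) (hb i (by omega))
            rw [Nat.even_add_one, ← ihi (by omega)]
            revert h2
            generalize c (f i) (f (i + 1)) = x, c (f (i + 1)) (f (i + 1 + 1)) = y,
              c (f 0) (f 1) = z
            revert x y z
            decide
        have h2 := hc _ _ _ (hf (n + 1) (by omega)) (hn ▸ hf 0 (by omega)) (Ne.symm h1)
        have h3 := key (n + 1) (by omega)
        rw [hn] at h2 h3
        rw [Nat.even_add_one, ← h3]
        exact h2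

theorem isBipartite_of_symmEdgeGraph_hom (φ : X.symmEdgeGraph →g Y.kroneckerDouble) :
    X.IsBipartite := by
  classical
  refine two_colorable_iff_forall_loop_even.2 fun u w => ?_
  let c : V → V → Bool := fun u v => if h : X.Adj u v then (φ ⟨(u, v), h⟩).2 = 0 else false
  refine even_of_closed_sequence (X := X) c ?_ _ w.getVert (fun i hi => w.adj_getVert_succ hi)
    (by simp)
  intro u v w h h' hne
  have h2 : (φ ⟨(u, v), h⟩).2 ≠ (φ ⟨(v, w), h'⟩).2 := (φ.map_adj (Or.inl ⟨rfl, hne⟩)).2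
  simp only [c, h, h', dif_pos, ne_eq, decide_eq_decide]
  omega

/-! ### Connected graphs of maximum degree two -/

theorem isPathGraph_or_isCycleGraph [Finite V] (hX : X.Connected)
    (hdeg : ∀ v a b c, X.Adj v a → X.Adj v b → X.Adj v c → a = b ∨ a = c ∨ b = c) :
    X.IsPathGraph ∨ X.IsCycleGraph := by
  have := hX.nonempty
  obtain ⟨u, v, p, hp, hmax⟩ := Walk.exists_isPath_forall_isPath_length_le_length X
  have hinj : ∀ i ≤ p.length, ∀ j ≤ p.length, p.getVert i = p.getVert j → i = j :=
    fun i hi j hj h => hp.getVert_injOn hi hj h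
  have hadj : ∀ i < p.length, X.Adj (p.getVert i) (p.getVert (i + 1)) :=
    fun i hi => p.adj_getVert_succ hi
  have hpred : ∀ i, 0 < i → i ≤ p.length → X.Adj (p.getVert i) (p.getVert (i - 1)) := by
    intro i h0 hi
    have := hadj (i - 1) (by omega)
    rw [Nat.sub_add_cancel h0] at this
    exact this.symm
  -- A neighbor outside the longest path `p` would extend it at an end or be a third neighbor of an
  -- inner vertex.
  have hclosed : ∀ x y, X.Adj x y → x ∈ p.support → y ∈ p.support := by
    intro x y hxy hx
    by_contra hy
    obtain ⟨i, rfl, hi⟩ := Walk.mem_support_iff_exists_getVert.1 hx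
    rcases Nat.eq_zero_or_pos i with rfl | h0
    · rw [Walk.getVert_zero] at hxy
      have := hmax _ _ (Walk.cons hxy.symm p) (hp.cons hy)
      simp at this
    · rcases hi.eq_or_lt with rfl | hi
      · rw [Walk.getVert_length] at hxy
        have := hmax _ _ (p.concat hxy) (hp.concat hy hxy)
        simp at this
      · rcases hdeg _ _ _ _ (hpred i h0 hi.le) (hadj i hi) hxy with h | h | h
        · have := hinj _ (by omega) _ (by omega) h
          omega
        · exact hy (h ▸ p.getVert_mem_support _)
        · exact hy (h ▸ p.getVert_mem_support _)
  have hall : ∀ y, y ∈ p.support := by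
    intro y
    obtain ⟨q⟩ := hX.preconnected u y
    have : ∀ a b (q : X.Walk a b), a ∈ p.support → b ∈ p.support := by
      intro a b q
      induction q with
      | nil => exact id
      | cons h _ ih => exact fun ha => ih (hclosed _ _ h ha)
    exact this _ _ q p.start_mem_support
  let e : Fin (p.length + 1) ≃ V := Equiv.ofBijective (fun i => p.getVert i) <| by
    refine ⟨fun i j h => Fin.ext (hinj _ (by omega) _ (by omega) h), fun y => ?_⟩
    obtain ⟨i, rfl, hi⟩ := Walk.mem_support_iff_exists_getVert.1 (hall y)
    exact ⟨⟨i, by omega⟩, rfl⟩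
  -- Any other chord would give an inner vertex a third neighbor.
  have hlt : ∀ i j, i < j → j ≤ p.length → X.Adj (p.getVert i) (p.getVert j) →
      j = i + 1 ∨ (i = 0 ∧ j = p.length) := by
    intro i j hij hj h
    by_contra! hne
    by_cases hi : i = 0
    · have hjl : j < p.length := lt_of_le_of_ne hj (hne.2 hi)
      rcases hdeg _ _ _ _ (hpred j (by omega) hj) (hadj j hjl) h.symm with h | h | h <;>
      · have := hinj _ (by omega) _ (by omega) h
        omega
    · rcases hdeg _ _ _ _ (hpred i (by omega) (by omega)) (hadj i (by omega)) h with h | h | h <;>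
      · have := hinj _ (by omega) _ (by omega) h
        omega
  by_cases hcyc : 2 ≤ p.length ∧ X.Adj (p.getVert 0) (p.getVert p.length)
  · refine Or.inr ⟨p.length + 1, by omega, ⟨RelIso.symm ⟨e, ?_⟩⟩⟩
    have key : ∀ i j : Fin (p.length + 1), i < j →
        (X.Adj (e i) (e j) ↔ (cycleGraph (p.length + 1)).Adj i j) := by
      intro i j hij
      have h1 : (j - i).val = j.val - i.val := Fin.coe_sub_iff_le.2 hij.le
      have h2 : (i - j).val = p.length + 1 + i.val - j.val := Fin.coe_sub_iff_lt.2 hij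
      rw [cycleGraph_adj', h1, h2]
      have hij' : i.val < j.val := hij
      refine ⟨fun h => ?_, ?_⟩
      · have := hlt i j hij (by omega) h
        omega
      · rintro (h | h)
        · have hi : i.val = 0 := by omega
          have hj : j.val = p.length := by omega
          change X.Adj (p.getVert i) (p.getVert j)
          rw [hi, hj]
          exact hcyc.2
        · have hj : j.val = i.val + 1 := by omega
          change X.Adj (p.getVert i) (p.getVert j)
          rw [hj]
          exact hadj _ (by omega)
    intro i j
    rcases lt_trichotomy i j with h | rfl | h
    · exact key i j h
    · simp
    · rw [X.adj_comm, key j i h, adj_comm]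
  · refine Or.inl ⟨p.length + 1, by omega, ⟨RelIso.symm ⟨e, ?_⟩⟩⟩
    have key : ∀ i j : Fin (p.length + 1), i < j →
        (X.Adj (e i) (e j) ↔ (pathGraph (p.length + 1)).Adj i j) := by
      intro i j hij
      rw [pathGraph_adj]
      have hij' : i.val < j.val := hij
      refine ⟨fun h => ?_, fun h => ?_⟩
      · rcases hlt i j hij (by omega) h with h1 | ⟨h1, h2⟩
        · omega
        · change X.Adj (p.getVert i) (p.getVert j) at h
          rw [h1, h2] at h
          have : ¬ 2 ≤ p.length := fun h' => hcyc ⟨h', h⟩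
          omega
      · have hj : j.val = i.val + 1 := by omega
        change X.Adj (p.getVert i) (p.getVert j)
        rw [hj]
        exact hadj _ (by omega)
    intro i j
    rcases lt_trichotomy i j with h | rfl | h
    · exact key i j h
    · simp
    · rw [X.adj_comm, key j i h, adj_comm]

/-- Three darts leaving one vertex form a triangle, but the layers two-color the target. -/
theorem degree_le_two_of_coincidenceGraph_hom (φ : X.coincidenceGraph →g Y.kroneckerDouble)
    (v a b c : V) (ha : X.Adj v a) (hb : X.Adj v b) (hc : X.Adj v c) :
    a = b ∨ a = c ∨ b = c := by
  have key : ∀ x y (hx : X.Adj v x) (hy : X.Adj v y), x ≠ y →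
      (φ ⟨(v, x), hx⟩).2 ≠ (φ ⟨(v, y), hy⟩).2 := fun x y hx hy hne =>
    (kroneckerDouble_adj.1 (φ.map_adj (coincidenceGraph_adj_of_ne hx hy hne))).2
  by_contra! h
  have h1 := key a b ha hb h.1
  have h2 := key a c ha hc h.2.1
  have h3 := key b c hb hc h.2.2
  omega

theorem IsPathGraph.isBipartite (h : X.IsPathGraph) : X.IsBipartite := by
  obtain ⟨n, -, ⟨φ⟩⟩ := h
  exact (pathGraph.bicoloring n).colorable.of_hom φ.toHom

theorem IsEvenCycleGraph.isBipartite (h : X.IsEvenCycleGraph) : X.IsBipartite := by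
  obtain ⟨n, -, hn, ⟨φ⟩⟩ := h
  exact (cycleGraph.bicoloring_of_even n hn).colorable.of_hom φ.toHom

theorem IsEvenCycleGraph.isCycleGraph (h : X.IsEvenCycleGraph) : X.IsCycleGraph := by
  obtain ⟨n, hn, -, h⟩ := h
  exact ⟨n, hn, h⟩

theorem IsCycleGraph.isEvenCycleGraph (h : X.IsCycleGraph) (hX : X.IsBipartite) :
    X.IsEvenCycleGraph := by
  obtain ⟨n, hn, ⟨φ⟩⟩ := h
  refine ⟨n, hn, Nat.not_odd_iff_even.1 fun hodd => ?_, ⟨φ⟩⟩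
  have h1 : (cycleGraph n).Colorable 2 := Colorable.of_hom φ.symm.toHom hX
  have h2 := h1.chromaticNumber_le
  rw [chromaticNumber_cycleGraph_of_odd n (by omega) hodd] at h2
  norm_cast at h2

/-! ### Graphs with a vertex of degree at least three -/

/-- Among any three neighbors of a dart in the coincidence graph two are equal or adjacent. -/
theorem coincidenceGraph_claw_free {e f g h : X.Dart} (hf : X.coincidenceGraph.Adj e f)
    (hg : X.coincidenceGraph.Adj e g) (hh : X.coincidenceGraph.Adj e h) :
    (f = g ∨ X.coincidenceGraph.Adj f g) ∨ (f = h ∨ X.coincidenceGraph.Adj f h) ∨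
      (g = h ∨ X.coincidenceGraph.Adj g h) := by
  simp only [coincidenceGraph_adj] at *
  have key : ∀ a b : X.Dart, a.fst = b.fst ∨ a.snd = b.snd →
      (a = b ∨ a ≠ b ∧ (a.fst = b.fst ∨ a.snd = b.snd)) := fun a b h => by tauto
  -- Pigeonhole: two of the three neighbors share the same endpoint with `e`.
  rcases hf.2 with h1 | h1 <;> rcases hg.2 with h2 | h2 <;> rcases hh.2 with h3 | h3 <;>
  first
    | exact Or.inl (key _ _ (Or.inl (h1.symm.trans h2)))
    | exact Or.inl (key _ _ (Or.inr (h1.symm.trans h2)))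
    | exact Or.inr (Or.inl (key _ _ (Or.inl (h1.symm.trans h3))))
    | exact Or.inr (Or.inl (key _ _ (Or.inr (h1.symm.trans h3))))
    | exact Or.inr (Or.inr (key _ _ (Or.inl (h2.symm.trans h3))))
    | exact Or.inr (Or.inr (key _ _ (Or.inr (h2.symm.trans h3))))

theorem symmEdgeGraph_claw_free (ψ : X.symmEdgeGraph ≃g Y.coincidenceGraph) {e f g h : X.Dart}
    (hf : X.symmEdgeGraph.Adj e f) (hg : X.symmEdgeGraph.Adj e g) (hh : X.symmEdgeGraph.Adj e h) :
    (f = g ∨ X.symmEdgeGraph.Adj f g) ∨ (f = h ∨ X.symmEdgeGraph.Adj f h) ∨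
      (g = h ∨ X.symmEdgeGraph.Adj g h) := by
  simpa only [ψ.injective.eq_iff, ψ.map_adj_iff] using
    coincidenceGraph_claw_free (ψ.map_adj_iff.2 hf) (ψ.map_adj_iff.2 hg) (ψ.map_adj_iff.2 hh)

/-- The triangles of the symmetric edge graph are the directed triangles of the graph. -/
theorem symmEdgeGraph_triangle {e f g : X.Dart} (h1 : X.symmEdgeGraph.Adj e f)
    (h2 : X.symmEdgeGraph.Adj f g) (h3 : X.symmEdgeGraph.Adj e g) :
    (e.snd = f.fst ∧ f.snd = g.fst ∧ g.snd = e.fst) ∨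
      (f.snd = e.fst ∧ g.snd = f.fst ∧ e.snd = g.fst) := by
  have he := e.fst_ne_snd
  have hf := f.fst_ne_snd
  have hg := g.fst_ne_snd
  rw [symmEdgeGraph_adj] at h1 h2 h3
  grind

/-- Two consecutive darts of a directed triangle determine the third. -/
theorem symmEdgeGraph_not_four_clique {e f g h : X.Dart} (h1 : X.symmEdgeGraph.Adj e f)
    (h2 : X.symmEdgeGraph.Adj f g) (h3 : X.symmEdgeGraph.Adj e g) (h4 : X.symmEdgeGraph.Adj f h)
    (h5 : X.symmEdgeGraph.Adj e h) : ¬ X.symmEdgeGraph.Adj g h := by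
  intro h6
  apply h6.ne
  rw [dart_eq_iff]
  have h7 := symmEdgeGraph_triangle h1 h2 h3
  have h8 := symmEdgeGraph_triangle h1 h4 h5
  rw [symmEdgeGraph_adj] at h1
  grind

/-- If the symmetric edge graph is isomorphic to the coincidence graph, then no vertex has four
distinct neighbors. -/
theorem eq_of_adj_of_symmEdgeGraph_iso (ψ : X.symmEdgeGraph ≃g Y.coincidenceGraph)
    {v a b c d : W} (ha : Y.Adj v a) (hb : Y.Adj v b) (hc : Y.Adj v c) (hd : Y.Adj v d)
    (hab : a ≠ b) (hac : a ≠ c) (hbc : b ≠ c) : d = a ∨ d = b ∨ d = c := by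
  have key : ∀ x y (hx : Y.Adj v x) (hy : Y.Adj v y), x ≠ y →
      X.symmEdgeGraph.Adj (ψ.symm ⟨(v, x), hx⟩) (ψ.symm ⟨(v, y), hy⟩) := fun x y hx hy hne =>
    ψ.symm.map_adj_iff.2 (coincidenceGraph_adj_of_ne hx hy hne)
  by_contra! h
  exact symmEdgeGraph_not_four_clique (key a b ha hb hab) (key b c hb hc hbc) (key a c ha hc hac)
    (key b d hb hd h.2.1.symm) (key a d ha hd h.1.symm) (key c d hc hd h.2.2.symm)

/-- Otherwise `(a, v)` would be the center of a claw with leaves `(v, b)`, `(v, c)` and `(y, a)`. -/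
theorem neighbor_mem_of_symmEdgeGraph_iso (ψ : X.symmEdgeGraph ≃g Y.coincidenceGraph)
    {v a b c y : V} (ha : X.Adj v a) (hb : X.Adj v b) (hc : X.Adj v c) (hab : a ≠ b) (hac : a ≠ c)
    (hbc : b ≠ c) (hy : X.Adj a y) (hyv : y ≠ v) : y = b ∨ y = c := by
  have h := symmEdgeGraph_claw_free ψ (e := ⟨(a, v), ha.symm⟩) (f := ⟨(v, b), hb⟩)
    (g := ⟨(v, c), hc⟩) (h := ⟨(y, a), hy.symm⟩) (Or.inl ⟨rfl, hab⟩) (Or.inl ⟨rfl, hac⟩)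
    (Or.inr ⟨rfl, hyv⟩)
  have hva := ha.ne
  have hvb := hb.ne
  have hvc := hc.ne
  simp only [symmEdgeGraph_adj, dart_eq_iff] at h
  grind

theorem exists_triangle_of_symmEdgeGraph_iso (ψ : X.symmEdgeGraph ≃g Y.coincidenceGraph)
    {v a b c : W} (ha : Y.Adj v a) (hb : Y.Adj v b) (hc : Y.Adj v c) (hab : a ≠ b) (hac : a ≠ c)
    (hbc : b ≠ c) : ∃ x y z, X.Adj x y ∧ X.Adj y z ∧ X.Adj z x := by
  have key : ∀ x y (hx : Y.Adj v x) (hy : Y.Adj v y), x ≠ y →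
      X.symmEdgeGraph.Adj (ψ.symm ⟨(v, x), hx⟩) (ψ.symm ⟨(v, y), hy⟩) := fun x y hx hy hne =>
    ψ.symm.map_adj_iff.2 (coincidenceGraph_adj_of_ne hx hy hne)
  have h := symmEdgeGraph_triangle (key a b ha hb hab) (key b c hb hc hbc) (key a c ha hc hac)
  generalize ψ.symm ⟨(v, a), ha⟩ = e, ψ.symm ⟨(v, b), hb⟩ = f, ψ.symm ⟨(v, c), hc⟩ = g at h
  obtain ⟨h1, h2, h3⟩ | ⟨h1, h2, h3⟩ := h
  · exact ⟨e.fst, f.fst, g.fst, h1 ▸ e.adj, h2 ▸ f.adj, h3 ▸ g.adj⟩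
  · exact ⟨f.fst, e.fst, g.fst, h1 ▸ f.adj, h3 ▸ e.adj, h2 ▸ g.adj⟩

theorem nonempty_iso_of_bijective {F : W → V} (hF : Function.Bijective F)
    (h : ∀ i j, X.Adj (F i) (F j) ↔ Y.Adj i j) : Nonempty (X ≃g Y) :=
  ⟨RelIso.symm ⟨Equiv.ofBijective F hF, fun {i j} => h i j⟩⟩

theorem bijective_vecCons_four {a b c d : V} (hab : a ≠ b) (hac : a ≠ c) (had : a ≠ d)
    (hbc : b ≠ c) (hbd : b ≠ d) (hcd : c ≠ d) (hall : ∀ x, x = a ∨ x = b ∨ x = c ∨ x = d) :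
    Function.Bijective ![a, b, c, d] := by
  constructor
  · intro i j h
    fin_cases i <;> fin_cases j <;> simp_all
  · intro x
    rcases hall x with rfl | rfl | rfl | rfl
    exacts [⟨0, rfl⟩, ⟨1, rfl⟩, ⟨2, rfl⟩, ⟨3, rfl⟩]

/-- A graph on four vertices with a dominating vertex and at least one further edge. -/
theorem iso_of_four_vertices {v a b c : V} (ha : X.Adj v a) (hb : X.Adj v b) (hc : X.Adj v c)
    (hab : X.Adj a b) (hac : a ≠ c) (hbc : b ≠ c) (hall : ∀ x, x = v ∨ x = a ∨ x = b ∨ x = c) :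
    Nonempty (X ≃g completeGraph (Fin 4)) ∨ Nonempty (X ≃g completeFourMinusEdge) ∨
      Nonempty (X ≃g triangleWithPendant) := by
  by_cases h1 : X.Adj a c <;> by_cases h2 : X.Adj b c
  · refine Or.inl (nonempty_iso_of_bijective (bijective_vecCons_four (a := v) (b := a) (c := b)
      (d := c) ha.ne hb.ne hc.ne hab.ne hac hbc hall) fun i j => ?_)
    simp only [completeGraph, top_adj]
    fin_cases i <;> fin_cases j <;>
      simp [ha, hb, hc, hab, ha.symm, hb.symm, hc.symm, hab.symm, h1, h2, X.adj_comm c]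
  -- The nonadjacent pair is listed first, to match the edge `s(0, 1)` that was removed.
  · refine Or.inr (Or.inl (nonempty_iso_of_bijective (bijective_vecCons_four (a := b) (b := c)
      (c := a) (d := v) hbc hab.ne.symm hb.ne.symm hac.symm hc.ne.symm ha.ne.symm
      (fun x => by have := hall x; tauto)) fun i j => ?_))
    simp only [completeFourMinusEdge_adj]
    fin_cases i <;> fin_cases j <;>
      simp [ha, hb, hc, hab, ha.symm, hb.symm, hc.symm, hab.symm, h1, h2, X.adj_comm c]
  · refine Or.inr (Or.inl (nonempty_iso_of_bijective (bijective_vecCons_four (a := a) (b := c)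
      (c := b) (d := v) hac hab.ne ha.ne.symm hbc.symm hc.ne.symm hb.ne.symm
      (fun x => by have := hall x; tauto)) fun i j => ?_))
    simp only [completeFourMinusEdge_adj]
    fin_cases i <;> fin_cases j <;>
      simp [ha, hb, hc, hab, ha.symm, hb.symm, hc.symm, hab.symm, h1, h2, X.adj_comm c]
  · refine Or.inr (Or.inr (nonempty_iso_of_bijective (bijective_vecCons_four (a := a) (b := b)
      (c := v) (d := c) hab.ne ha.ne.symm hac hb.ne.symm hbc hc.ne
      (fun x => by have := hall x; tauto)) fun i j => ?_))
    simp only [triangleWithPendant_adj]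
    fin_cases i <;> fin_cases j <;>
      simp [ha, hb, hc, hab, ha.symm, hb.symm, hc.symm, hab.symm, h1, h2, X.adj_comm c]

theorem iso_of_symmEdgeGraph_iso_of_three_neighbors (hX : X.Connected)
    (ψ : X.symmEdgeGraph ≃g X.coincidenceGraph) {v a b c : V} (ha : X.Adj v a) (hb : X.Adj v b)
    (hc : X.Adj v c) (hab : a ≠ b) (hac : a ≠ c) (hbc : b ≠ c) :
    Nonempty (X ≃g completeGraph (Fin 4)) ∨ Nonempty (X ≃g completeFourMinusEdge) ∨
      Nonempty (X ≃g triangleWithPendant) := by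
  have hclosed : ∀ x y, X.Adj x y → (x = v ∨ x = a ∨ x = b ∨ x = c) →
      (y = v ∨ y = a ∨ y = b ∨ y = c) := by
    intro x y hxy hx
    by_cases hyv : y = v
    · exact Or.inl hyv
    right
    rcases hx with rfl | rfl | rfl | rfl
    · exact eq_of_adj_of_symmEdgeGraph_iso ψ ha hb hc hxy hab hac hbc
    · exact Or.inr (neighbor_mem_of_symmEdgeGraph_iso ψ ha hb hc hab hac hbc hxy hyv)
    · have := neighbor_mem_of_symmEdgeGraph_iso ψ hb ha hc hab.symm hbc hac hxy hyv
      tauto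
    · have := neighbor_mem_of_symmEdgeGraph_iso ψ hc ha hb hac.symm hbc.symm hab hxy hyv
      tauto
  have hall : ∀ x, x = v ∨ x = a ∨ x = b ∨ x = c := by
    intro x
    obtain ⟨q⟩ := hX.preconnected v x
    have : ∀ s t (q : X.Walk s t), (s = v ∨ s = a ∨ s = b ∨ s = c) →
        (t = v ∨ t = a ∨ t = b ∨ t = c) := by
      intro s t q
      induction q with
      | nil => exact id
      | cons h _ ih => exact fun hs => ih (hclosed _ _ h hs)
    exact this _ _ q (Or.inl rfl)
  -- Without such an edge `X` would be a star, which has no triangle.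
  have hedge : X.Adj a b ∨ X.Adj a c ∨ X.Adj b c := by
    obtain ⟨x, y, z, hxy, hyz, hzx⟩ := exists_triangle_of_symmEdgeGraph_iso ψ ha hb hc hab hac hbc
    have h1 := hxy.ne
    have h2 := hyz.ne
    have h3 := hzx.ne
    rcases hall x with rfl | rfl | rfl | rfl <;> rcases hall y with rfl | rfl | rfl | rfl <;>
      rcases hall z with rfl | rfl | rfl | rfl <;> simp_all [adj_comm]
  rcases hedge with h | h | h
  · exact iso_of_four_vertices ha hb hc h hac hbc hall
  · exact iso_of_four_vertices ha hc hb h hab hbc.symm fun x => by have := hall x; tauto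
  · exact iso_of_four_vertices hb hc ha h hab.symm hac.symm fun x => by have := hall x; tauto

end SimpleGraph

/-! ### The main theorem -/

open SimpleGraph in
theorem mainTheorem1 {V : Type*} [Finite V] (X : SimpleGraph V) (hX : X.Connected) :
    (Nonempty (X.symmEdgeGraph ≃g X.lineGraph.kroneckerDouble) ↔ X.IsBipartite) ∧
    (Nonempty (X.symmEdgeGraph ≃g X.kroneckerDouble.lineGraph) ↔
      X.IsPathGraph ∨ X.IsEvenCycleGraph ∨
        Nonempty (X ≃g SimpleGraph.completeGraph (Fin 4)) ∨
        Nonempty (X ≃g SimpleGraph.completeFourMinusEdge) ∨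
        Nonempty (X ≃g SimpleGraph.triangleWithPendant)) ∧
    (Nonempty (X.kroneckerDouble.lineGraph ≃g X.lineGraph.kroneckerDouble) ↔
      X.IsCycleGraph ∨ X.IsPathGraph) := by
  have part1 : Nonempty (X.symmEdgeGraph ≃g X.lineGraph.kroneckerDouble) ↔ X.IsBipartite :=
    ⟨fun ⟨ψ⟩ => isBipartite_of_symmEdgeGraph_hom ψ.toHom, fun h => h.nonempty_symmEdgeGraph_iso⟩
  have cover_iso : X.IsCycleGraph ∨ X.IsPathGraph →
      Nonempty (X.coincidenceGraph ≃g X.lineGraph.kroneckerDouble) := fun h =>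
    h.elim (fun h => h.nonempty_coincidenceGraph_iso) fun h => h.nonempty_coincidenceGraph_iso
  have part2 : Nonempty (X.symmEdgeGraph ≃g X.coincidenceGraph) ↔
      X.IsPathGraph ∨ X.IsEvenCycleGraph ∨ Nonempty (X ≃g completeGraph (Fin 4)) ∨
        Nonempty (X ≃g completeFourMinusEdge) ∨ Nonempty (X ≃g triangleWithPendant) := by
    constructor
    · rintro ⟨ψ⟩
      by_cases hdeg : ∀ v a b c, X.Adj v a → X.Adj v b → X.Adj v c → a = b ∨ a = c ∨ b = c
      · rcases isPathGraph_or_isCycleGraph hX hdeg with h | h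
        · exact Or.inl h
        · obtain ⟨ψ'⟩ := cover_iso (Or.inl h)
          exact Or.inr (Or.inl (h.isEvenCycleGraph (part1.1 ⟨ψ.trans ψ'⟩)))
      · push Not at hdeg
        obtain ⟨v, a, b, c, ha, hb, hc, hab, hac, hbc⟩ := hdeg
        exact Or.inr (Or.inr
          (iso_of_symmEdgeGraph_iso_of_three_neighbors hX ψ ha hb hc hab hac hbc))
    · rintro (h | h | ⟨⟨φ⟩⟩ | ⟨⟨φ⟩⟩ | ⟨⟨φ⟩⟩)
      · obtain ⟨ψ⟩ := part1.2 h.isBipartite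
        exact (cover_iso (Or.inr h)).map fun ψ' => ψ.trans ψ'.symm
      · obtain ⟨ψ⟩ := part1.2 h.isBipartite
        exact (cover_iso (Or.inl h.isCycleGraph)).map fun ψ' => ψ.trans ψ'.symm
      · exact nonempty_symmEdgeGraph_iso_coincidenceGraph_congr φ
          nonempty_symmEdgeGraph_iso_completeGraph_four
      · exact nonempty_symmEdgeGraph_iso_coincidenceGraph_congr φ
          nonempty_symmEdgeGraph_iso_completeFourMinusEdge
      · exact nonempty_symmEdgeGraph_iso_coincidenceGraph_congr φ
          nonempty_symmEdgeGraph_iso_triangleWithPendant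
  refine ⟨part1, ?_, ?_⟩
  · rw [← part2]
    exact ⟨fun ⟨ψ⟩ => ⟨ψ.trans (coincidenceGraphIso X).symm⟩,
      fun ⟨ψ⟩ => ⟨ψ.trans (coincidenceGraphIso X)⟩⟩
  · refine ⟨fun ⟨ψ⟩ => ?_, fun h => (cover_iso h).map fun ψ => (coincidenceGraphIso X).symm.trans ψ⟩
    exact (isPathGraph_or_isCycleGraph hX
      (degree_le_two_of_coincidenceGraph_hom (Iso.toHom ((coincidenceGraphIso X).trans ψ)))).symm
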